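/- Let $A=a_0\mathbb 1+\boldsymbol a\cdot\boldsymbol\sigma=a_0\mathbb 1+\sum_{i=1}^3 a_i\sigma_i$ be a qubit observable, where $(a_0,\boldsymbol a)\in\mathbb R^4$, $\boldsymbol a\neq 0$, $\sigma_1,\sigma_2,\sigma_3$ are the standard Pauli matrices and $|\boldsymbol a|=(a_1^2+a_2^2+a_3^2)^{1/2}$. Fix any unit vector $\Phi\in\mathbb C^2\otimes\mathbb C^2$, let $U$ be a unitary on $\mathbb C^2\otimes\mathbb C^2$ distributed according to the normalized Haar measure of the full unitary group, and let $\rho=\mathrm{Tr}_2\big(U|\Phi\rangle\langle\Phi|U^\dagger\big)$ be the random qubit state obtained from the Haar-distributed pure state $U|\Phi\rangle$ by the partial trace over the second factor. Then the uncertainty $$\Delta_\rho A=\sqrt{\mathrm{Tr}(A^2\rho)-(\mathrm{Tr}(A\rho))^2}$$ is a random variable whose law on $\mathbb R$ is absolutely continuous with respect to Lebesgue measure, with density $$f_{\Delta A}(x)=\frac{3x^3}{2|\boldsymbol a|^3\sqrt{|\boldsymbol a|^2-x^2}}\quad\text{for } 0\le x<|\boldsymbol a|,\qquad f_{\Delta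 A}(x)=0\quad\text{otherwise.}$$ -/

import Mathlib

open MeasureTheory Matrix
open scoped ComplexOrder

noncomputable section

namespace RandomQubit

/-! ### Quantum states -/

/-- Quantum states (pure or mixed) on the Hilbert space with orthonormal basis indexed by `n`:
positive semidefinite matrices of trace one. -/
def DensityMatrix (n : Type*) [Fintype n] : Type _ :=
  {ρ : Matrix n n ℂ // ρ.PosSemidef ∧ ρ.trace = 1}

/-- The Borel structure inherited from the space of complex matrices (entrywise). -/
instance {n : Type*} [Fintype n] : MeasurableSpace (DensityMatrix n) :=
  MeasurableSpace.comap (fun ρ (i j : n) => ρ.1 i j) MeasurableSpace.pi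

/-- Unit vectors of the Hilbert space with orthonormal basis indexed by `n`. For `n = p × q` this
is the space `ℂ^p ⊗ ℂ^q` with the product basis. -/
abbrev PureState (n : Type*) [Fintype n] : Type _ :=
  Metric.sphere (0 : EuclideanSpace ℂ n) 1

theorem PureState.dotProduct_star {n : Type*} [Fintype n] (ψ : PureState n) :
    ψ.1.ofLp ⬝ᵥ star ψ.1.ofLp = 1 := by
  have h : ‖ψ.1‖ = 1 := mem_sphere_zero_iff_norm.1 ψ.2
  have h2 := inner_self_eq_norm_sq_to_K (𝕜 := ℂ) ψ.1
  rw [EuclideanSpace.inner_eq_star_dotProduct, h] at h2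
  simpa using h2

/-- The rank-one projection `|ψ⟩⟨ψ|`. -/
def PureState.proj {n : Type*} [Fintype n] (ψ : PureState n) : Matrix n n ℂ :=
  vecMulVec ψ.1.ofLp (star ψ.1.ofLp)

/-- Partial trace over the second tensor factor. -/
def partialTrace {p q : Type*} [Fintype q] (M : Matrix (p × q) (p × q) ℂ) : Matrix p p ℂ :=
  Matrix.of fun i j => ∑ k, M (i, k) (j, k)

/-- The reduced state `Tr₂ |ψ⟩⟨ψ|` of a bipartite pure state. -/
def PureState.reduced {p q : Type*} [Fintype p] [Fintype q] (ψ : PureState (p × q)) :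
    DensityMatrix p :=
  ⟨partialTrace ψ.proj, by
    have h : partialTrace ψ.proj
        = (Matrix.of fun (i : p) (k : q) => ψ.1.ofLp (i, k)) *
          (Matrix.of fun (i : p) (k : q) => ψ.1.ofLp (i, k))ᴴ := by
      ext i j
      simp [partialTrace, PureState.proj, Matrix.mul_apply, vecMulVec_apply]
    rw [h]
    exact posSemidef_self_mul_conjTranspose _, by
    have h := ψ.dotProduct_star
    simpa [partialTrace, PureState.proj, Matrix.trace, dotProduct, vecMulVec_apply,
      Fintype.sum_prod_type] using h⟩

/-! ### Haar-distributed pure states and the induced random mixed state -/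

/-- The action of a unitary matrix on unit vectors, `|ψ⟩ ↦ U|ψ⟩`. -/
def PureState.act {n : Type*} [Fintype n] [DecidableEq n] (U : unitaryGroup n ℂ)
    (ψ : PureState n) : PureState n :=
  ⟨WithLp.toLp 2 (U.1 *ᵥ ψ.1.ofLp), by
    have h : ‖ψ.1‖ = 1 := mem_sphere_zero_iff_norm.1 ψ.2
    refine mem_sphere_zero_iff_norm.2 (Eq.trans ?_ h)
    rw [← sq_eq_sq₀ (norm_nonneg _) (norm_nonneg _)]
    have h2 : ((‖(WithLp.toLp 2 (U.1 *ᵥ ψ.1.ofLp) : EuclideanSpace ℂ n)‖ ^ 2 : ℝ) : ℂ)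
        = ((‖ψ.1‖ ^ 2 : ℝ) : ℂ) := by
      have e1 := inner_self_eq_norm_sq_to_K (𝕜 := ℂ)
        (WithLp.toLp 2 (U.1 *ᵥ ψ.1.ofLp) : EuclideanSpace ℂ n)
      have e2 := inner_self_eq_norm_sq_to_K (𝕜 := ℂ) ψ.1
      rw [EuclideanSpace.inner_eq_star_dotProduct] at e1 e2
      have hU : U.1ᴴ * U.1 = 1 := (mem_unitaryGroup_iff').1 U.2
      have e3 : (U.1 *ᵥ ψ.1.ofLp) ⬝ᵥ star (U.1 *ᵥ ψ.1.ofLp)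
          = ψ.1.ofLp ⬝ᵥ star ψ.1.ofLp := by
        rw [star_mulVec, dotProduct_comm, ← dotProduct_mulVec, mulVec_mulVec, hU, one_mulVec,
          dotProduct_comm]
      push_cast
      exact e1.symm.trans (e3.trans e2)
    exact_mod_cast h2⟩

/-- The unitary group is compact. -/
instance {n : Type*} [Fintype n] [DecidableEq n] : CompactSpace (unitaryGroup n ℂ) := by
  have hsub : (unitaryGroup n ℂ : Set (Matrix n n ℂ)) ⊆
      Set.pi Set.univ fun _ : n => Set.pi Set.univ fun _ : n => Metric.closedBall (0 : ℂ) 1 := by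
    intro U hU i _ j _
    rw [mem_closedBall_zero_iff]
    exact entry_norm_bound_of_unitary hU i j
  have hcl : IsClosed (unitaryGroup n ℂ : Set (Matrix n n ℂ)) := by
    have : (unitaryGroup n ℂ : Set (Matrix n n ℂ)) = {U | star U * U = 1} := by
      ext U
      exact mem_unitaryGroup_iff'
    rw [this]
    exact isClosed_eq (by fun_prop) continuous_const
  exact isCompact_iff_compactSpace.1 (IsCompact.of_isClosed_subset
    (isCompact_univ_pi fun _ => isCompact_univ_pi fun _ => isCompact_closedBall _ _) hcl hsub)

instance {n : Type*} [Fintype n] [DecidableEq n] : MeasurableSpace (unitaryGroup n ℂ) :=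
  borel _

instance {n : Type*} [Fintype n] [DecidableEq n] : BorelSpace (unitaryGroup n ℂ) :=
  ⟨rfl⟩

/-- The normalized Haar measure on the unitary group. -/
def haarUnitary (n : Type*) [Fintype n] [DecidableEq n] : Measure (unitaryGroup n ℂ) :=
  Measure.haarMeasure ⊤

/-- The law of `U|Φ⟩` with `U` a Haar-distributed unitary and `Φ` a fixed pure state. -/
def haarPure {n : Type*} [Fintype n] [DecidableEq n] (Φ : PureState n) : Measure (PureState n) :=
  (haarUnitary n).map fun U => Φ.act U

/-- The law of the reduced state `Tr₂ |ψ⟩⟨ψ|`, with `ψ = U|Φ⟩` a Haar-distributed pure state. -/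
def inducedMeasure {p q : Type*} [Fintype p] [Fintype q] [DecidableEq p] [DecidableEq q]
    (Φ : PureState (p × q)) : Measure (DensityMatrix p) :=
  (haarPure Φ).map PureState.reduced

/-! ### Observables and their uncertainties -/

/-- The expectation `⟨X⟩_ρ = Tr (X ρ)`, which is real for Hermitian `X`. -/
def expect {n : Type*} [Fintype n] (X : Matrix n n ℂ) (ρ : DensityMatrix n) : ℝ :=
  (X * ρ.1).trace.re

/-- The uncertainty (standard deviation) `Δ_ρ A`, where `(Δ_ρ A)² = ⟨A²⟩_ρ - ⟨A⟩_ρ²`. -/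
def stdDev {n : Type*} [Fintype n] (A : Matrix n n ℂ) (ρ : DensityMatrix n) : ℝ :=
  Real.sqrt (expect (A * A) ρ - expect A ρ ^ 2)

/-- The three Pauli matrices. -/
def pauli : Fin 3 → Matrix (Fin 2) (Fin 2) ℂ :=
  ![!![0, 1; 1, 0], !![0, -Complex.I; Complex.I, 0], !![1, 0; 0, -1]]

/-- The qubit observable `a₀ 1 + a · σ`. -/
def qubitObs (a₀ : ℝ) (a : EuclideanSpace ℝ (Fin 3)) : Matrix (Fin 2) (Fin 2) ℂ :=
  (a₀ : ℂ) • (1 : Matrix (Fin 2) (Fin 2) ℂ) + ∑ i, (a i : ℂ) • pauli i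

end RandomQubit

end

/-! In an eigenbasis of `A` the outcome takes two values at distance `2|a|`, with probabilities the
squared norms of the two rows of the bipartite amplitude vector. The variance of a two-valued
variable is the product of the probabilities times the squared gap, so the uncertainty is `2|a|`
times the product of the row norms (`exists_stdDev_qubitObs_eq`). The change of basis is a unitary
on the first factor, absorbed by left invariance of Haar measure.

A Haar average over unit vectors equals the average over the unit ball of the degree-0 homogeneous
extension (`setLIntegral_ball_eq_lintegral_act`). In the ball the two rows are coordinates in `ℂ² =
ℝ⁴` with radii `r`, `s` and weight `r³s³` on the quarter disc. Integrating out the scale leaves the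
ratio `u = s/r` with weight proportional to `u³/(1+u²)⁴` (`lintegral_quarterDisc_ratio`), and the
uncertainty is `x = |a|·2u/(1+u²)`. This map is two-to-one, with branches exchanged by `u ↦ 1/u`;
changing variables on each branch gives the density. The constant comes from applying the same
formula to the function 1, which yields the volume of the ball. -/

namespace RandomQubit

/-! ### Haar measure on the unitary group and its action on unit vectors. -/

variable {n : Type*} [Fintype n] [DecidableEq n]

instance : SecondCountableTopology (unitaryGroup n ℂ) :=
  haveI : SecondCountableTopology (Matrix n n ℂ) :=
    inferInstanceAs (SecondCountableTopology (n → n → ℂ))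
  inferInstanceAs (SecondCountableTopology (unitaryGroup n ℂ : Set (Matrix n n ℂ)))

instance : Measure.IsHaarMeasure (haarUnitary n) :=
  inferInstanceAs (Measure.IsHaarMeasure (Measure.haarMeasure ⊤))

instance : IsProbabilityMeasure (haarUnitary n) :=
  ⟨by simpa [haarUnitary] using
    Measure.haarMeasure_self (K₀ := (⊤ : TopologicalSpace.PositiveCompacts (unitaryGroup n ℂ)))⟩

/-- A right translate is again a left Haar probability measure, so uniqueness identifies it with the
original. Right invariance is what makes an orbit average independent of the starting vector. -/
instance : Measure.IsMulRightInvariant (haarUnitary n) := by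
  refine ⟨fun g => ?_⟩
  have : IsProbabilityMeasure ((haarUnitary n).map (· * g)) :=
    Measure.isProbabilityMeasure_map (by fun_prop)
  exact Measure.isHaarMeasure_eq_of_isProbabilityMeasure _ _

/-- Matrices act on the Hilbert space; the star multiplicative equivalence underlying
`Matrix.toEuclideanCLM`. -/
noncomputable def matrixStarMulEquiv :
    Matrix n n ℂ ≃⋆* (EuclideanSpace ℂ n →L[ℂ] EuclideanSpace ℂ n) where
  toEquiv := (Matrix.toEuclideanCLM (n := n) (𝕜 := ℂ)).toEquiv
  map_mul' := map_mul (Matrix.toEuclideanCLM (n := n) (𝕜 := ℂ))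
  map_star' := map_star (Matrix.toEuclideanCLM (n := n) (𝕜 := ℂ))

/-- The isometry of the Hilbert space given by a unitary matrix. -/
noncomputable def unitaryIsometry (U : unitaryGroup n ℂ) :
    EuclideanSpace ℂ n ≃ₗᵢ[ℂ] EuclideanSpace ℂ n :=
  Unitary.linearIsometryEquiv (Unitary.mapEquiv matrixStarMulEquiv U)

theorem unitaryIsometry_apply (U : unitaryGroup n ℂ) (z : EuclideanSpace ℂ n) :
    unitaryIsometry U z = WithLp.toLp 2 (U.1 *ᵥ z.ofLp) := rfl

theorem act_val (U : unitaryGroup n ℂ) (ψ : PureState n) :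
    (ψ.act U).1 = unitaryIsometry U ψ.1 := rfl

theorem unitaryIsometry_mul (U V : unitaryGroup n ℂ) (z : EuclideanSpace ℂ n) :
    unitaryIsometry (U * V) z = unitaryIsometry U (unitaryIsometry V z) := by
  simp [unitaryIsometry_apply, mulVec_mulVec]

theorem continuous_unitaryIsometry_uncurry :
    Continuous fun p : unitaryGroup n ℂ × EuclideanSpace ℂ n => unitaryIsometry p.1 p.2 := by
  simp only [unitaryIsometry_apply]
  refine (PiLp.continuous_toLp 2 _).comp ?_
  exact (continuous_subtype_val.comp continuous_fst).matrix_mulVec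
    ((PiLp.continuous_ofLp 2 _).comp continuous_snd)

/-- The unitary group acts transitively on unit vectors. -/
theorem exists_unitaryIsometry_eq (x y : EuclideanSpace ℂ n) (hx : ‖x‖ = 1) (hy : ‖y‖ = 1) :
    ∃ U : unitaryGroup n ℂ, unitaryIsometry U x = y := by
  have hn : Nonempty n := by
    by_contra h
    rw [not_nonempty_iff] at h
    have : x = 0 := Subsingleton.elim _ _
    simp [this] at hx
  obtain ⟨i⟩ := hn
  -- Each unit vector extends to an orthonormal basis with that vector at the same index `i`; the
  -- unitary carrying one basis to the other then sends `x` to `y`.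
  have key : ∀ v : EuclideanSpace ℂ n, ‖v‖ = 1 →
      ∃ b : OrthonormalBasis n ℂ (EuclideanSpace ℂ n), b i = v := by
    intro v hv
    obtain ⟨b, hb⟩ := Orthonormal.exists_orthonormalBasis_extension_of_card_eq (𝕜 := ℂ)
      (E := EuclideanSpace ℂ n) (ι := n) (by simp) (v := fun _ => v) (s := {i}) (by
        refine ⟨fun j => by simpa using hv, fun j k hjk => (hjk ?_).elim⟩
        exact Subsingleton.elim _ _)
    exact ⟨b, hb i rfl⟩
  obtain ⟨b, hb⟩ := key x hx
  obtain ⟨c, hc⟩ := key y hy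
  let U : unitaryGroup n ℂ :=
    (Unitary.mapEquiv matrixStarMulEquiv).symm
      (Unitary.linearIsometryEquiv.symm (b.equiv c (Equiv.refl n)))
  have : unitaryIsometry U = b.equiv c (Equiv.refl n) := by
    simp only [unitaryIsometry, U, StarMulEquiv.apply_symm_apply, MulEquiv.apply_symm_apply]
  refine ⟨U, ?_⟩
  rw [this, ← hb, ← hc]
  simp

end RandomQubit

/-! ### Averages over the unitary group as averages over the ball; polar coordinates. -/

/-- An additive Haar measure on a normed space is invariant under linear isometries. -/
theorem LinearIsometryEquiv.measurePreserving_addHaar {E : Type*} [NormedAddCommGroup E]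
    [NormedSpace ℝ E] [FiniteDimensional ℝ E] [MeasurableSpace E] [BorelSpace E]
    (μ : Measure E) [μ.IsAddHaarMeasure] (L : E ≃ₗᵢ[ℝ] E) : MeasurePreserving L μ μ := by
  refine ⟨L.continuous.measurable, ?_⟩
  have hdet : LinearMap.det (L.toLinearEquiv : E →ₗ[ℝ] E) ≠ 0 :=
    (LinearEquiv.isUnit_det' _).ne_zero
  have h := Measure.map_linearMap_addHaar_eq_smul_addHaar μ hdet
  have hL : ⇑(L.toLinearEquiv : E →ₗ[ℝ] E) = L := rfl
  rw [hL] at h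
  -- The isometry preserves the unit ball, whose measure is positive and finite, so the scaling
  -- factor `|det|⁻¹` must be 1.
  have hb := congrArg (fun ν => ν (Metric.ball (0 : E) 1)) h
  simp only [Measure.smul_apply, smul_eq_mul] at hb
  rw [Measure.map_apply L.continuous.measurable measurableSet_ball, L.preimage_ball] at hb
  have h0 : μ (Metric.ball (0 : E) 1) ≠ 0 := (Metric.measure_ball_pos μ 0 one_pos).ne'
  have ht : μ (Metric.ball (0 : E) 1) ≠ ⊤ := measure_ball_lt_top.ne
  rw [map_zero] at hb
  have hc : ENNReal.ofReal |(LinearMap.det (L.toLinearEquiv : E →ₗ[ℝ] E))⁻¹| = 1 := by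
    rw [← ENNReal.mul_left_inj h0 ht, one_mul]
    exact hb.symm
  rw [h, hc, one_smul]

namespace RandomQubit

variable {n : Type*} [Fintype n] [DecidableEq n]

/-- The integral over the unit ball of a function depending only on the direction is, up to the
volume of the ball, its average over the unitary orbit of a unit vector. -/
theorem setLIntegral_ball_eq_lintegral_act [Nonempty n] (μ : Measure (EuclideanSpace ℂ n))
    [μ.IsAddHaarMeasure] (Φ : PureState n) {F : EuclideanSpace ℂ n → ENNReal} (hF : Measurable F)
    (hom : ∀ (c : ℝ) z, 0 < c → F (c • z) = F z) :
    ∫⁻ z in Metric.ball 0 1, F z ∂μ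
      = μ (Metric.ball 0 1) * ∫⁻ U, F (unitaryIsometry U Φ.1) ∂haarUnitary n := by
  have h1 : ∀ U : unitaryGroup n ℂ,
      ∫⁻ z in Metric.ball 0 1, F (unitaryIsometry U z) ∂μ = ∫⁻ z in Metric.ball 0 1, F z ∂μ := by
    intro U
    have hL : MeasurePreserving (unitaryIsometry U) μ μ :=
      LinearIsometryEquiv.measurePreserving_addHaar μ
        (L := { (unitaryIsometry U).toLinearEquiv.restrictScalars ℝ with
                norm_map' := (unitaryIsometry U).norm_map })
    have := (hL.setLIntegral_comp_preimage (s := Metric.ball 0 1) measurableSet_ball hF)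
    rwa [LinearIsometryEquiv.preimage_ball, map_zero] at this
  -- By homogeneity `z` may be normalised; by transitivity it is then `V Φ`, and right invariance
  -- removes `V`.
  have h2 : ∀ z : EuclideanSpace ℂ n, z ≠ 0 →
      ∫⁻ U, F (unitaryIsometry U z) ∂haarUnitary n
        = ∫⁻ U, F (unitaryIsometry U Φ.1) ∂haarUnitary n := by
    intro z hz
    have hz' : 0 < ‖z‖ := norm_pos_iff.2 hz
    obtain ⟨V, hV⟩ := exists_unitaryIsometry_eq Φ.1 (‖z‖⁻¹ • z)
      (mem_sphere_zero_iff_norm.1 Φ.2) (by simp [norm_smul, hz'.ne'])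
    have : ∀ U, F (unitaryIsometry U z) = F (unitaryIsometry (U * V) Φ.1) := by
      intro U
      have hs : unitaryIsometry U (‖z‖⁻¹ • z) = ‖z‖⁻¹ • unitaryIsometry U z :=
        (unitaryIsometry U).toLinearEquiv.toLinearMap.map_smul_of_tower _ _
      rw [unitaryIsometry_mul, hV, hs, hom _ _ (inv_pos.2 hz')]
    simp_rw [this]
    exact lintegral_mul_right_eq_self (fun U => F (unitaryIsometry U Φ.1)) V
  calc ∫⁻ z in Metric.ball 0 1, F z ∂μ
      = ∫⁻ _U, ∫⁻ z in Metric.ball 0 1, F z ∂μ ∂haarUnitary n := by simp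
    _ = ∫⁻ U, ∫⁻ z in Metric.ball 0 1, F (unitaryIsometry U z) ∂μ ∂haarUnitary n := by
        simp_rw [h1]
    _ = ∫⁻ z in Metric.ball 0 1, ∫⁻ U, F (unitaryIsometry U z) ∂haarUnitary n ∂μ :=
        lintegral_lintegral_swap
          (hF.comp continuous_unitaryIsometry_uncurry.measurable).aemeasurable
    _ = ∫⁻ z in Metric.ball 0 1, ∫⁻ U, F (unitaryIsometry U Φ.1) ∂haarUnitary n ∂μ := by
        refine lintegral_congr_ae (ae_restrict_of_ae ?_)
        filter_upwards [Measure.ae_ne μ 0] with z hz using h2 z hz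
    _ = _ := by simp [mul_comm]

end RandomQubit

/-- Integration of a radial function with respect to an additive Haar measure. -/
theorem MeasureTheory.lintegral_fun_norm_addHaar {E : Type*} [NormedAddCommGroup E]
    [NormedSpace ℝ E] [Nontrivial E] [FiniteDimensional ℝ E] [MeasurableSpace E] [BorelSpace E]
    (μ : Measure E) [μ.IsAddHaarMeasure] {f : ℝ → ENNReal} (hf : Measurable f) :
    ∫⁻ x, f ‖x‖ ∂μ = μ.toSphere Set.univ *
      ∫⁻ r in Set.Ioi (0 : ℝ), ENNReal.ofReal (r ^ (Module.finrank ℝ E - 1)) * f r := by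
  have h := μ.measurePreserving_homeomorphUnitSphereProd
  calc ∫⁻ x, f ‖x‖ ∂μ = ∫⁻ x : ({(0)}ᶜ : Set E), f ‖x.1‖ ∂(μ.comap (↑)) := by
        rw [lintegral_subtype_comap (measurableSet_singleton _).compl fun x => f ‖x‖,
          restrict_compl_singleton]
    _ = ∫⁻ x, f x.2 ∂μ.toSphere.prod (.volumeIoiPow (Module.finrank ℝ E - 1)) := by
        simpa using h.lintegral_comp
          (f := fun p => f p.2) (hf.comp (measurable_subtype_coe.comp measurable_snd))
    _ = μ.toSphere Set.univ *
        ∫⁻ x : Set.Ioi (0 : ℝ), f x ∂.volumeIoiPow (Module.finrank ℝ E - 1) := by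
        rw [lintegral_prod _ (by fun_prop)]
        simp [mul_comm]
    _ = _ := by
        congr 1
        rw [Measure.volumeIoiPow, lintegral_withDensity_eq_lintegral_mul _ (by fun_prop)
          (by fun_prop)]
        exact lintegral_subtype_comap measurableSet_Ioi
          fun r => ENNReal.ofReal (r ^ (Module.finrank ℝ E - 1)) * f r

/-! ### The uncertainty in terms of amplitudes in an eigenbasis. -/

namespace RandomQubit

section Rows

variable {p q : Type*}

/-- The components of a bipartite vector along the basis of the first factor. -/
def row (i : p) (z : EuclideanSpace ℂ (p × q)) : EuclideanSpace ℂ q :=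
  WithLp.toLp 2 fun j => z (i, j)

theorem continuous_row (i : p) :
    Continuous (row i : EuclideanSpace ℂ (p × q) → EuclideanSpace ℂ q) := by
  unfold row
  fun_prop

theorem row_smul (i : p) (c : ℝ) (z : EuclideanSpace ℂ (p × q)) : row i (c • z) = c • row i z := by
  ext j
  simp [row]

variable [Fintype p] [Fintype q]

theorem sum_norm_row_sq (z : EuclideanSpace ℂ (p × q)) : ∑ i, ‖row i z‖ ^ 2 = ‖z‖ ^ 2 := by
  simp [EuclideanSpace.norm_sq_eq, row, Fintype.sum_prod_type]

variable [DecidableEq p] [DecidableEq q]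

/-- The unitary `V ⊗ 1` acting on the first factor. -/
def unitaryLeft (V : unitaryGroup p ℂ) : unitaryGroup (p × q) ℂ :=
  ⟨kroneckerMap (· * ·) V.1 1, kronecker_mem_unitary V.2 (one_mem _)⟩

/-- Reshaping a bipartite vector into a `p × q` matrix turns `V ⊗ 1` into left multiplication by
`V`. -/
theorem row_unitaryLeft (V : unitaryGroup p ℂ) (z : EuclideanSpace ℂ (p × q)) (i : p) (j : q) :
    row i (unitaryIsometry (unitaryLeft V) z) j
      = (V.1 * Matrix.of fun (i : p) (k : q) => z (i, k)) i j := by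
  simp [row, unitaryIsometry_apply, unitaryLeft, mulVec, dotProduct, Fintype.sum_prod_type,
    Matrix.mul_apply, Matrix.one_apply]

/-- If `M` is the amplitude matrix, the reduced state is `M Mᴴ`. Cyclicity of the trace moves `V`
onto `M`, and the diagonal entries of `(V* M)(V* M)ᴴ` are squared row norms. -/
theorem expect_conj_diagonal (V : unitaryGroup p ℂ) (l : p → ℝ) (ψ : PureState (p × q)) :
    expect (V.1 * diagonal (fun i => (l i : ℂ)) * star V.1) ψ.reduced
      = ∑ i, l i * ‖row i (unitaryIsometry (unitaryLeft (star V)) ψ.1)‖ ^ 2 := by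
  set M : Matrix p q ℂ := Matrix.of fun (i : p) (k : q) => ψ.1.ofLp (i, k) with hM
  have h : ψ.reduced.1 = M * Mᴴ := by
    ext i j
    simp [M, PureState.reduced, partialTrace, PureState.proj, Matrix.mul_apply, vecMulVec_apply]
  have h2 : (V.1 * diagonal (fun i => (l i : ℂ)) * star V.1 * ψ.reduced.1).trace
      = (diagonal (fun i => (l i : ℂ)) * ((star V.1 * M) * (star V.1 * M)ᴴ)).trace := by
    rw [h, conjTranspose_mul, star_eq_conjTranspose, conjTranspose_conjTranspose,
      Matrix.mul_assoc, Matrix.mul_assoc, trace_mul_comm]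
    simp only [Matrix.mul_assoc]
  rw [expect, h2, Matrix.trace, Complex.re_sum]
  refine Finset.sum_congr rfl fun i _ => ?_
  rw [diag_apply, diagonal_mul, Complex.re_ofReal_mul, EuclideanSpace.norm_sq_eq]
  congr 1
  rw [Matrix.mul_apply, Complex.re_sum]
  refine Finset.sum_congr rfl fun j _ => ?_
  rw [row_unitaryLeft, conjTranspose_apply, ← Complex.normSq_eq_norm_sq,
    Complex.star_def, Complex.mul_conj, Complex.ofReal_re]
  rfl

theorem stdDev_conj_diagonal (V : unitaryGroup p ℂ) (l : p → ℝ) (ψ : PureState (p × q)) :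
    stdDev (V.1 * diagonal (fun i => (l i : ℂ)) * star V.1) ψ.reduced
      = Real.sqrt (∑ i, l i ^ 2 * ‖row i (unitaryIsometry (unitaryLeft (star V)) ψ.1)‖ ^ 2
        - (∑ i, l i * ‖row i (unitaryIsometry (unitaryLeft (star V)) ψ.1)‖ ^ 2) ^ 2) := by
  have hsq : V.1 * diagonal (fun i => (l i : ℂ)) * star V.1 *
      (V.1 * diagonal (fun i => (l i : ℂ)) * star V.1)
      = V.1 * diagonal (fun i => ((l i ^ 2 : ℝ) : ℂ)) * star V.1 := by
    have hV : star V.1 * V.1 = 1 := mem_unitaryGroup_iff'.1 V.2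
    calc _ = V.1 * diagonal (fun i => (l i : ℂ)) * (star V.1 * V.1) *
          diagonal (fun i => (l i : ℂ)) * star V.1 := by simp only [Matrix.mul_assoc]
      _ = _ := by
        rw [hV, Matrix.mul_one, Matrix.mul_assoc V.1, diagonal_mul_diagonal]
        simp [sq]
  rw [stdDev, hsq, expect_conj_diagonal, expect_conj_diagonal]

end Rows

theorem qubitObs_eq (a₀ : ℝ) (a : EuclideanSpace ℝ (Fin 3)) :
    qubitObs a₀ a = !![(a₀ + a 2 : ℂ), a 0 - a 1 * Complex.I; a 0 + a 1 * Complex.I, a₀ - a 2] := by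
  ext i j
  fin_cases i <;> fin_cases j <;> simp [qubitObs, pauli, Fin.sum_univ_three] <;> ring

theorem isHermitian_qubitObs (a₀ : ℝ) (a : EuclideanSpace ℝ (Fin 3)) :
    (qubitObs a₀ a).IsHermitian := by
  rw [qubitObs_eq]
  ext i j
  fin_cases i <;> fin_cases j <;> simp [sub_eq_add_neg]

/-- The uncertainty of a qubit observable in terms of amplitudes in its eigenbasis. -/
theorem exists_stdDev_qubitObs_eq {q : Type*} [Fintype q] [DecidableEq q] (a₀ : ℝ)
    (a : EuclideanSpace ℝ (Fin 3)) :
    ∃ W : unitaryGroup (Fin 2 × q) ℂ, ∀ ψ : PureState (Fin 2 × q),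
      stdDev (qubitObs a₀ a) ψ.reduced
        = 2 * ‖a‖ * (‖row 0 (unitaryIsometry W ψ.1)‖ * ‖row 1 (unitaryIsometry W ψ.1)‖) := by
  -- Only the trace and determinant of the eigenvalues are needed: the variance depends on them
  -- through `(l 0 - l 1)²`, the discriminant of the characteristic polynomial.
  obtain ⟨V, l, hspec, htr, hdet⟩ : ∃ (V : unitaryGroup (Fin 2) ℂ) (l : Fin 2 → ℝ),
      qubitObs a₀ a = V.1 * diagonal (fun i => (l i : ℂ)) * star V.1 ∧
      (qubitObs a₀ a).trace = ∑ i, (l i : ℂ) ∧ (qubitObs a₀ a).det = ∏ i, (l i : ℂ) := by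
    have hA := isHermitian_qubitObs a₀ a
    refine ⟨hA.eigenvectorUnitary, hA.eigenvalues, ?_, hA.trace_eq_sum_eigenvalues,
      hA.det_eq_prod_eigenvalues⟩
    conv_lhs => rw [hA.spectral_theorem]
    rfl
  have htr' : l 0 + l 1 = 2 * a₀ := by
    have : (qubitObs a₀ a).trace = ((2 * a₀ : ℝ) : ℂ) := by
      rw [qubitObs_eq, trace_fin_two]
      simp
      ring
    rw [this, Fin.sum_univ_two] at htr
    exact_mod_cast htr.symm
  have hdet' : l 0 * l 1 = a₀ ^ 2 - ‖a‖ ^ 2 := by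
    have : (qubitObs a₀ a).det = ((a₀ ^ 2 - ‖a‖ ^ 2 : ℝ) : ℂ) := by
      rw [qubitObs_eq, det_fin_two, EuclideanSpace.norm_sq_eq, Fin.sum_univ_three]
      simp
      linear_combination ((a 1 : ℂ) ^ 2) * Complex.I_sq
    rw [this, Fin.prod_univ_two] at hdet
    exact_mod_cast hdet.symm
  refine ⟨unitaryLeft (star V), fun ψ => ?_⟩
  rw [hspec, stdDev_conj_diagonal]
  set z := unitaryIsometry (unitaryLeft (star V)) ψ.1
  have hz : ‖row 0 z‖ ^ 2 + ‖row 1 z‖ ^ 2 = 1 := by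
    have h := sum_norm_row_sq z
    rw [Fin.sum_univ_two] at h
    have h1 : ‖z‖ = 1 := by
      rw [LinearIsometryEquiv.norm_map]
      exact mem_sphere_zero_iff_norm.1 ψ.2
    rw [h, h1, one_pow]
  rw [← Real.sqrt_sq (show 0 ≤ 2 * ‖a‖ * (‖row 0 z‖ * ‖row 1 z‖) by positivity),
    Fin.sum_univ_two, Fin.sum_univ_two]
  congr 1
  -- The variance of a two-valued variable is the product of the two probabilities times this
  -- squared gap, since the probabilities sum to 1 by `hz`.
  have hl : (l 0 - l 1) ^ 2 = 4 * ‖a‖ ^ 2 := by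
    linear_combination (l 0 + l 1 + 2 * a₀) * htr' - 4 * hdet'
  linear_combination (‖row 0 z‖ ^ 2 * ‖row 1 z‖ ^ 2) * hl
    - (l 0 ^ 2 * ‖row 0 z‖ ^ 2 + l 1 ^ 2 * ‖row 1 z‖ ^ 2) * hz

/-! ### Measurability and transport of integrals to the unitary group. -/

theorem measurable_expect {n : Type*} [Fintype n] (X : Matrix n n ℂ) : Measurable (expect X) := by
  have h : ∀ i j : n, Measurable fun ρ : DensityMatrix n => ρ.1 i j := fun i j =>
    (measurable_pi_apply j).comp ((measurable_pi_apply i).comp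
      (comap_measurable fun (ρ : DensityMatrix n) (i j : n) => ρ.1 i j))
  unfold expect
  simp only [Matrix.trace, diag_apply, Matrix.mul_apply]
  exact Complex.measurable_re.comp (Finset.measurable_sum _ fun i _ =>
    Finset.measurable_sum _ fun j _ => (h j i).const_mul _)

theorem measurable_stdDev {n : Type*} [Fintype n] (A : Matrix n n ℂ) : Measurable (stdDev A) :=
  (((measurable_expect _).sub ((measurable_expect _).pow_const 2))).sqrt

theorem measurable_act {n : Type*} [Fintype n] [DecidableEq n] (Φ : PureState n) :
    Measurable fun U : unitaryGroup n ℂ => Φ.act U :=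
  Measurable.subtype_mk (f := fun U : unitaryGroup n ℂ => unitaryIsometry U Φ.1)
    (continuous_unitaryIsometry_uncurry.comp (Continuous.prodMk_left Φ.1)).measurable

theorem measurable_reduced {p q : Type*} [Fintype p] [Fintype q] :
    Measurable (PureState.reduced : PureState (p × q) → DensityMatrix p) := by
  refine Measurable.of_comap_le ?_
  change (MeasurableSpace.comap _ (MeasurableSpace.comap _ _)) ≤ _
  rw [MeasurableSpace.comap_comp, ← measurable_iff_comap_le]
  refine measurable_pi_lambda _ fun i => measurable_pi_lambda _ fun j => ?_
  simp only [Function.comp_def, PureState.reduced, partialTrace, PureState.proj, of_apply,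
    vecMulVec_apply, Pi.star_apply]
  have h : ∀ k, Measurable fun ψ : PureState (p × q) => ψ.1.ofLp k := fun k => by
    have : Continuous fun ψ : PureState (p × q) => ψ.1.ofLp k := by fun_prop
    exact this.measurable
  refine Finset.measurable_sum _ fun k _ => (h _).mul ?_
  exact continuous_star.measurable.comp (h _)

/-- Integration against the law of an observable quantity of the induced random state. -/
theorem lintegral_map_inducedMeasure {p q : Type*} [Fintype p] [Fintype q] [DecidableEq p]
    [DecidableEq q] (Φ : PureState (p × q)) {f : DensityMatrix p → ℝ} (hf : Measurable f)
    {g : ℝ → ENNReal} (hg : Measurable g) :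
    ∫⁻ x, g x ∂((inducedMeasure Φ).map f)
      = ∫⁻ U, g (f (Φ.act U).reduced) ∂haarUnitary (p × q) := by
  have hgf : Measurable fun ρ => g (f ρ) := hg.comp hf
  have hgfr : Measurable fun ψ : PureState (p × q) => g (f ψ.reduced) := hgf.comp measurable_reduced
  rw [lintegral_map hg hf, inducedMeasure, lintegral_map hgf measurable_reduced, haarPure,
    lintegral_map hgfr (measurable_act Φ)]

end RandomQubit

/-! ### The ratio of the two radii. -/

namespace RandomQubit

theorem lintegral_Ioi_comp_mul_left {r : ℝ} (hr : 0 < r) (f : ℝ → ENNReal) :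
    ∫⁻ s in Set.Ioi (0 : ℝ), f s = ENNReal.ofReal r * ∫⁻ u in Set.Ioi (0 : ℝ), f (r * u) := by
  have him : (fun u => r * u) '' Set.Ioi (0 : ℝ) = Set.Ioi 0 := by
    rw [Set.image_mul_left_Ioi hr, mul_zero]
  have h := lintegral_image_eq_lintegral_abs_deriv_mul (f := fun u => r * u) (f' := fun _ => r)
    measurableSet_Ioi
    (fun u _ => by simpa using ((hasDerivAt_id u).const_mul r).hasDerivWithinAt (s := Set.Ioi 0))
    (mul_right_injective₀ hr.ne').injOn f
  rw [him] at h
  rw [h, abs_of_pos hr, lintegral_const_mul' _ _ ENNReal.ofReal_ne_top]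

theorem lintegral_pow_Ioo {b : ℝ} (hb : 0 ≤ b) (k : ℕ) :
    ∫⁻ r in Set.Ioo 0 b, ENNReal.ofReal (r ^ k) = ENNReal.ofReal (b ^ (k + 1) / (k + 1)) := by
  rw [setLIntegral_congr Ioo_ae_eq_Ioc, ← ofReal_integral_eq_lintegral_ofReal,
    ← intervalIntegral.integral_of_le hb, integral_pow]
  · simp
  · exact ((continuous_pow k).integrableOn_Icc).mono_set Set.Ioc_subset_Icc_self
  · exact (ae_restrict_iff' measurableSet_Ioc).2 (.of_forall fun r hr => pow_nonneg hr.1.le _)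

/-- Polar-type decomposition: integrating a function of the ratio `s / r` over a quarter disc. -/
theorem lintegral_quarterDisc_ratio {h : ℝ → ENNReal} (hh : Measurable h) :
    ∫⁻ r in Set.Ioi (0 : ℝ), ENNReal.ofReal (r ^ 3) * ∫⁻ s in Set.Ioi (0 : ℝ),
        ENNReal.ofReal (s ^ 3) * (Set.Iio 1).indicator (fun _ => h (s / r)) (r ^ 2 + s ^ 2)
      = ENNReal.ofReal (1 / 8) *
        ∫⁻ u in Set.Ioi (0 : ℝ), ENNReal.ofReal (u ^ 3 / (1 + u ^ 2) ^ 4) * h u := by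
  -- Substituting `s = r u` gives `r³ · r · (r u)³ = r⁷ u³`, and the disc condition becomes `r² (1 +
  -- u²) < 1`.
  have h1 : ∀ r ∈ Set.Ioi (0 : ℝ), ENNReal.ofReal (r ^ 3) * ∫⁻ s in Set.Ioi (0 : ℝ),
        ENNReal.ofReal (s ^ 3) * (Set.Iio 1).indicator (fun _ => h (s / r)) (r ^ 2 + s ^ 2)
      = ∫⁻ u in Set.Ioi (0 : ℝ), (ENNReal.ofReal (u ^ 3) * h u) *
        (ENNReal.ofReal (r ^ 7) * (Set.Iio 1).indicator (fun _ => 1) (r ^ 2 * (1 + u ^ 2))) := by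
    intro r hr
    have hr : 0 < r := hr
    rw [lintegral_Ioi_comp_mul_left hr, ← mul_assoc, ← ENNReal.ofReal_mul (by positivity),
      ← lintegral_const_mul' _ _ ENNReal.ofReal_ne_top]
    refine setLIntegral_congr_fun measurableSet_Ioi fun u hu => ?_
    have hu : 0 < u := hu
    have e1 : r ^ 2 + (r * u) ^ 2 = r ^ 2 * (1 + u ^ 2) := by ring
    have e2 : r * u / r = u := by field_simp
    simp only [e1, e2]
    have e3 : r ^ 7 = r ^ 3 * r * r ^ 3 := by ring
    rw [mul_pow, e3, ENNReal.ofReal_mul (p := r ^ 3 * r) (by positivity),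
      ENNReal.ofReal_mul (p := r ^ 3) (q := u ^ 3) (by positivity)]
    by_cases hin : r ^ 2 * (1 + u ^ 2) ∈ Set.Iio (1 : ℝ)
    · rw [Set.indicator_of_mem hin, Set.indicator_of_mem hin]
      ring
    · rw [Set.indicator_of_notMem hin, Set.indicator_of_notMem hin]
      simp
  -- For fixed `u` the radius runs up to `b = (1 + u²)^(-1/2)`, and the integral of `r⁷` is `b⁸/8`.
  have h2 : ∀ u ∈ Set.Ioi (0 : ℝ), ∫⁻ r in Set.Ioi (0 : ℝ), (ENNReal.ofReal (u ^ 3) * h u) *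
        (ENNReal.ofReal (r ^ 7) * (Set.Iio 1).indicator (fun _ => 1) (r ^ 2 * (1 + u ^ 2)))
      = ENNReal.ofReal (1 / 8) * (ENNReal.ofReal (u ^ 3 / (1 + u ^ 2) ^ 4) * h u) := by
    intro u hu
    have hu : 0 < u := hu
    set b : ℝ := (Real.sqrt (1 + u ^ 2))⁻¹ with hb
    have hb0 : 0 < b := by positivity
    have hb2 : b ^ 2 = (1 + u ^ 2)⁻¹ := by
      rw [hb, inv_pow, Real.sq_sqrt (by positivity)]
    have hmeas : Measurable fun r : ℝ => ENNReal.ofReal (r ^ 7) *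
        (Set.Iio 1).indicator (fun _ => (1 : ENNReal)) (r ^ 2 * (1 + u ^ 2)) := by
      refine Measurable.mul (by fun_prop) ?_
      exact (measurable_const.indicator measurableSet_Iio).comp
        (f := fun r : ℝ => r ^ 2 * (1 + u ^ 2)) (by fun_prop)
    have h3 : ∫⁻ r in Set.Ioi (0 : ℝ), ENNReal.ofReal (r ^ 7) *
        (Set.Iio 1).indicator (fun _ => (1 : ENNReal)) (r ^ 2 * (1 + u ^ 2))
        = ENNReal.ofReal (b ^ 8 / 8) := by
      have h4 := lintegral_pow_Ioo hb0.le 7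
      norm_num at h4
      rw [← h4, ← lintegral_indicator measurableSet_Ioi, ← lintegral_indicator measurableSet_Ioo]
      refine lintegral_congr fun r => ?_
      by_cases hr : 0 < r
      · have hiff : r ^ 2 * (1 + u ^ 2) < 1 ↔ r < b := by
          rw [← lt_div_iff₀ (by positivity), one_div, ← hb2, sq_lt_sq₀ hr.le hb0.le]
        by_cases hrb : r < b
        · simp [Set.indicator, hr, hrb, hiff]
        · simp [Set.indicator, hr, hrb, hiff]
      · simp [Set.indicator, hr]
    rw [lintegral_const_mul _ hmeas, h3, mul_right_comm, ← ENNReal.ofReal_mul (by positivity),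
      ← mul_assoc, ← ENNReal.ofReal_mul (by positivity)]
    congr 2
    rw [show b ^ 8 = (b ^ 2) ^ 4 by ring, hb2]
    field_simp
  rw [setLIntegral_congr_fun measurableSet_Ioi h1, lintegral_lintegral_swap,
    setLIntegral_congr_fun measurableSet_Ioi h2, lintegral_const_mul' _ _ ENNReal.ofReal_ne_top]
  refine Measurable.aemeasurable ?_
  refine Measurable.mul ?_ (Measurable.mul (by fun_prop) ?_)
  · exact Measurable.mul (by fun_prop) (hh.comp measurable_snd)
  · exact (measurable_const.indicator measurableSet_Iio).comp
      (f := fun p : ℝ × ℝ => p.1 ^ 2 * (1 + p.2 ^ 2)) (by fun_prop)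

/-- With `w = 1/(1+u²)` an antiderivative is `-w²/4 + w³/6`, which equals `-1/12` at 0 and vanishes
at infinity. This fixes the normalisation. -/
theorem lintegral_ratio_density :
    ∫⁻ u in Set.Ioi (0 : ℝ), ENNReal.ofReal (u ^ 3 / (1 + u ^ 2) ^ 4)
      = ENNReal.ofReal (1 / 12) := by
  have hderiv : ∀ u ∈ Set.Ici (0 : ℝ), HasDerivAt
      (fun u : ℝ => -(1 / 4) * ((1 + u ^ 2)⁻¹) ^ 2 + 1 / 6 * ((1 + u ^ 2)⁻¹) ^ 3)
      (u ^ 3 / (1 + u ^ 2) ^ 4) u := by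
    intro u _
    have hpos : (1 + u ^ 2) ≠ 0 := by positivity
    have h0 : HasDerivAt (fun u : ℝ => (1 + u ^ 2)⁻¹) (-(2 * u) / (1 + u ^ 2) ^ 2) u := by
      have h := ((hasDerivAt_pow 2 u).const_add 1).fun_inv hpos
      norm_num at h
      exact h
    refine (((h0.fun_pow 2).const_mul (-(1 / 4))).fun_add
      ((h0.fun_pow 3).const_mul (1 / 6))).congr_deriv ?_
    simp only [Nat.cast_ofNat, Nat.add_one_sub_one, pow_one]
    field_simp
    ring
  have hnn : ∀ u ∈ Set.Ioi (0 : ℝ), 0 ≤ u ^ 3 / (1 + u ^ 2) ^ 4 := fun u hu => by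
    have : 0 < u := hu
    positivity
  have hlim : Filter.Tendsto
      (fun u : ℝ => -(1 / 4) * ((1 + u ^ 2)⁻¹) ^ 2 + 1 / 6 * ((1 + u ^ 2)⁻¹) ^ 3)
      Filter.atTop (nhds 0) := by
    have h0 : Filter.Tendsto (fun u : ℝ => (1 + u ^ 2)⁻¹) Filter.atTop (nhds 0) :=
      (Filter.tendsto_atTop_add_const_left _ 1
        (Filter.tendsto_pow_atTop two_ne_zero)).inv_tendsto_atTop
    have h := ((h0.pow 2).const_mul (-(1 / 4))).add ((h0.pow 3).const_mul (1 / 6))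
    norm_num only at h
    exact h
  rw [← ofReal_integral_eq_lintegral_ofReal,
    integral_Ioi_of_hasDerivAt_of_nonneg' hderiv hnn hlim]
  · norm_num
  · exact integrableOn_Ioi_deriv_of_nonneg' hderiv hnn hlim
  · exact (ae_restrict_iff' measurableSet_Ioi).2 (.of_forall hnn)

/-! ### The two-to-one change of variables from the ratio to the uncertainty. -/

theorem hasDerivAt_two_mul_div (α u : ℝ) : HasDerivAt (fun u : ℝ => α * (2 * u / (1 + u ^ 2)))
    (α * (2 * (1 - u ^ 2) / (1 + u ^ 2) ^ 2)) u := by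
  have hpos : (1 + u ^ 2) ≠ 0 := by positivity
  refine ((((hasDerivAt_id' u).const_mul 2).fun_div ((hasDerivAt_pow 2 u).const_add 1)
    hpos).const_mul α).congr_deriv ?_
  simp only [Nat.cast_ofNat, Nat.add_one_sub_one, pow_one]
  congr 2
  ring

theorem image_two_mul_div_Ioo {α : ℝ} (hα : 0 < α) :
    (fun u : ℝ => α * (2 * u / (1 + u ^ 2))) '' Set.Ioo 0 1 = Set.Ioo 0 α := by
  apply Set.Subset.antisymm
  · rintro _ ⟨u, ⟨h0, h1⟩, rfl⟩
    refine ⟨by positivity, ?_⟩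
    have : 2 * u / (1 + u ^ 2) < 1 := by
      rw [div_lt_one (by positivity)]
      nlinarith [sq_pos_of_pos (sub_pos.2 h1)]
    exact mul_lt_of_lt_one_right hα this
  · have h := intermediate_value_Ioo (f := fun u : ℝ => α * (2 * u / (1 + u ^ 2))) zero_le_one
      (fun u _ => (hasDerivAt_two_mul_div α u).continuousAt.continuousWithinAt)
    norm_num at h
    simpa using h

/-- The map is invariant under `u ↦ u⁻¹`, which exchanges the two branches. -/
theorem image_two_mul_div_Ioi {α : ℝ} (hα : 0 < α) :
    (fun u : ℝ => α * (2 * u / (1 + u ^ 2))) '' Set.Ioi 1 = Set.Ioo 0 α := by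
  have hinv : ∀ u : ℝ, u ≠ 0 → α * (2 * u⁻¹ / (1 + u⁻¹ ^ 2)) = α * (2 * u / (1 + u ^ 2)) := by
    intro u hu
    have : u ^ 2 + 1 ≠ 0 := by positivity
    have : 1 + u ^ 2 ≠ 0 := by positivity
    field_simp
    ring
  rw [← image_two_mul_div_Ioo hα]
  apply Set.Subset.antisymm
  · rintro _ ⟨u, hu, rfl⟩
    have hu : 1 < u := hu
    have h0 : 0 < u := one_pos.trans hu
    exact ⟨u⁻¹, ⟨inv_pos.2 h0, inv_lt_one_of_one_lt₀ hu⟩, hinv u h0.ne'⟩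
  · rintro _ ⟨u, ⟨h0, h1⟩, rfl⟩
    exact ⟨u⁻¹, (one_lt_inv₀ h0).2 h1, hinv u h0.ne'⟩

/-- Equal values at `u` and `v` force `(u - v)(1 - u v) = 0`, so reciprocal pairs are the only
obstruction to injectivity. -/
theorem injOn_two_mul_div {α : ℝ} (hα : 0 < α) {s : Set ℝ} (hs : ∀ u ∈ s, ∀ v ∈ s, u * v ≠ 1) :
    Set.InjOn (fun u : ℝ => α * (2 * u / (1 + u ^ 2))) s := by
  intro u hu v hv h
  have h := mul_left_cancel₀ hα.ne' h
  rw [div_eq_div_iff (by positivity) (by positivity)] at h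
  have h' : (u - v) * (1 - u * v) = 0 := by linear_combination h / 2
  rcases mul_eq_zero.1 h' with h' | h'
  · exact sub_eq_zero.1 h'
  · exact (hs u hu v hv (sub_eq_zero.1 h').symm).elim

/-- The density of the uncertainty of a qubit observable with Bloch vector of length `α`. -/
noncomputable def uncertaintyDensity (α : ℝ) : ℝ → ℝ :=
  (Set.Ico 0 α).indicator fun x => 3 * x ^ 3 / (2 * α ^ 3 * Real.sqrt (α ^ 2 - x ^ 2))

/-- At `x = α·2u/(1+u²)` the root `√(α² - x²)` equals `α|1-u²|/(1+u²)`, so the singularity of the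
density cancels the zero of the derivative at `u = 1`. -/
theorem abs_deriv_mul_uncertaintyDensity {α : ℝ} (hα : 0 < α) {u : ℝ} (hu : 0 < u) (hu1 : u ≠ 1)
    (hmem : α * (2 * u / (1 + u ^ 2)) ∈ Set.Ioo 0 α) :
    |α * (2 * (1 - u ^ 2) / (1 + u ^ 2) ^ 2)| * uncertaintyDensity α (α * (2 * u / (1 + u ^ 2)))
      = 24 * (u ^ 3 / (1 + u ^ 2) ^ 4) := by
  rw [uncertaintyDensity, Set.indicator_of_mem (Set.Ioo_subset_Ico_self hmem)]
  have hne : |1 - u ^ 2| ≠ 0 := by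
    rw [abs_ne_zero, show 1 - u ^ 2 = (1 - u) * (1 + u) by ring]
    exact mul_ne_zero (sub_ne_zero.2 hu1.symm) (by positivity)
  have hsqrt : Real.sqrt (α ^ 2 - (α * (2 * u / (1 + u ^ 2))) ^ 2)
      = α * (|1 - u ^ 2| / (1 + u ^ 2)) := by
    rw [← Real.sqrt_sq (show 0 ≤ α * (|1 - u ^ 2| / (1 + u ^ 2)) by positivity)]
    congr 1
    rw [mul_pow α (|1 - u ^ 2| / _), div_pow |1 - u ^ 2|, sq_abs]
    field_simp
    ring
  rw [hsqrt, abs_mul, abs_of_pos hα, abs_div, abs_mul, abs_of_pos (two_pos : (0 : ℝ) < 2),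
    abs_of_pos (show 0 < (1 + u ^ 2) ^ 2 by positivity)]
  field_simp
  norm_num

/-- Stated for a general `s` so as to serve both branches. Each branch alone covers `(0, α)`, hence
the factor 24 although the weight over both branches has mass `1/12`. -/
theorem lintegral_uncertaintyDensity_mul {α : ℝ} (hα : 0 < α) (g : ℝ → ENNReal)
    {s : Set ℝ} (hs : MeasurableSet s) (hpos : ∀ u ∈ s, 0 < u) (hne : ∀ u ∈ s, ∀ v ∈ s, u * v ≠ 1)
    (him : (fun u : ℝ => α * (2 * u / (1 + u ^ 2))) '' s = Set.Ioo 0 α) :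
    ∫⁻ x, ENNReal.ofReal (uncertaintyDensity α x) * g x = ENNReal.ofReal 24 *
      ∫⁻ u in s, ENNReal.ofReal (u ^ 3 / (1 + u ^ 2) ^ 4) * g (α * (2 * u / (1 + u ^ 2))) := by
  have h1 : ∫⁻ x, ENNReal.ofReal (uncertaintyDensity α x) * g x
      = ∫⁻ x in Set.Ioo 0 α, ENNReal.ofReal (uncertaintyDensity α x) * g x := by
    rw [setLIntegral_congr Ioo_ae_eq_Ico, ← lintegral_indicator measurableSet_Ico]
    refine lintegral_congr fun x => ?_
    by_cases hx : x ∈ Set.Ico 0 α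
    · rw [Set.indicator_of_mem hx]
    · rw [Set.indicator_of_notMem hx, uncertaintyDensity, Set.indicator_of_notMem hx]
      simp
  rw [h1, ← him, lintegral_image_eq_lintegral_abs_deriv_mul hs
    (fun u _ => (hasDerivAt_two_mul_div α u).hasDerivWithinAt) (injOn_two_mul_div hα hne),
    ← lintegral_const_mul' _ _ ENNReal.ofReal_ne_top]
  refine setLIntegral_congr_fun hs fun u hu => ?_
  have hu1 : u ≠ 1 := fun h => hne u hu u hu (by rw [h, one_mul])
  rw [← mul_assoc, ← mul_assoc, ← ENNReal.ofReal_mul (abs_nonneg _),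
    ← ENNReal.ofReal_mul (by norm_num),
    abs_deriv_mul_uncertaintyDensity hα (hpos u hu) hu1 (him ▸ Set.mem_image_of_mem _ hu)]

/-- The branches `(0,1)` and `(1,∞)` contribute `1/24` each; the point 1 is negligible. -/
theorem lintegral_ratio_eq_lintegral_uncertaintyDensity {α : ℝ} (hα : 0 < α) (g : ℝ → ENNReal) :
    ∫⁻ u in Set.Ioi (0 : ℝ),
        ENNReal.ofReal (u ^ 3 / (1 + u ^ 2) ^ 4) * g (α * (2 * u / (1 + u ^ 2)))
      = ENNReal.ofReal (1 / 12) * ∫⁻ x, ENNReal.ofReal (uncertaintyDensity α x) * g x := by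
  have hI := lintegral_uncertaintyDensity_mul hα g (s := Set.Ioo 0 1) measurableSet_Ioo
    (fun u hu => hu.1) (fun u hu v hv => (mul_lt_one_of_nonneg_of_lt_one_left hu.1.le hu.2
      hv.2.le).ne) (image_two_mul_div_Ioo hα)
  have hJ := lintegral_uncertaintyDensity_mul hα g (s := Set.Ioi 1) measurableSet_Ioi
    (fun u hu => one_pos.trans hu) (fun u hu v hv => (one_lt_mul_of_lt_of_le hu (le_of_lt hv)).ne')
    (image_two_mul_div_Ioi hα)
  have hsplit : Set.Ioi (0 : ℝ) = Set.Ioc 0 1 ∪ Set.Ioi 1 :=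
    (Set.Ioc_union_Ioi_eq_Ioi zero_le_one).symm
  rw [hsplit, lintegral_union measurableSet_Ioi (Set.Ioc_disjoint_Ioi le_rfl),
    ← setLIntegral_congr (Ioo_ae_eq_Ioc (μ := volume) (a := (0 : ℝ)) (b := 1))]
  have h24 : ENNReal.ofReal (1 / 24) * ENNReal.ofReal 24 = 1 := by
    rw [← ENNReal.ofReal_mul (by norm_num)]
    norm_num
  have hI' := congrArg (ENNReal.ofReal (1 / 24) * ·) hI
  have hJ' := congrArg (ENNReal.ofReal (1 / 24) * ·) hJ
  simp only [← mul_assoc (ENNReal.ofReal (1 / 24)), h24, one_mul] at hI' hJ'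
  rw [← hI', ← hJ', ← add_mul, ← ENNReal.ofReal_add (by norm_num) (by norm_num)]
  norm_num

end RandomQubit

/-! ### Polar coordinates in both rows and the law of the amplitudes. -/

namespace RandomQubit

/-- A vector of `ℂ² ⊗ ℂ^q` as the pair of its components. -/
noncomputable def ofRows (q : Type*) [Fintype q] :
    (EuclideanSpace ℂ q × EuclideanSpace ℂ q) ≃L[ℝ] EuclideanSpace ℂ (Fin 2 × q) :=
  LinearEquiv.toContinuousLinearEquiv
    { toFun := fun p => WithLp.toLp 2 fun ij => if ij.1 = 0 then p.1 ij.2 else p.2 ij.2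
      invFun := fun z => (row 0 z, row 1 z)
      map_add' := fun p p' => by
        ext ⟨i, j⟩
        fin_cases i <;> simp
      map_smul' := fun c p => by
        ext ⟨i, j⟩
        fin_cases i <;> simp
      left_inv := fun p => by ext j <;> simp [row]
      right_inv := fun z => by
        ext ⟨i, j⟩
        fin_cases i <;> simp [row] }

section

variable {q : Type*} [Fintype q]

theorem row_zero_ofRows (p : EuclideanSpace ℂ q × EuclideanSpace ℂ q) :
    row 0 (ofRows q p) = p.1 :=
  congrArg Prod.fst ((ofRows q).symm_apply_apply p)

theorem row_one_ofRows (p : EuclideanSpace ℂ q × EuclideanSpace ℂ q) :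
    row 1 (ofRows q p) = p.2 :=
  congrArg Prod.snd ((ofRows q).symm_apply_apply p)

theorem norm_ofRows_sq (p : EuclideanSpace ℂ q × EuclideanSpace ℂ q) :
    ‖ofRows q p‖ ^ 2 = ‖p.1‖ ^ 2 + ‖p.2‖ ^ 2 := by
  rw [← sum_norm_row_sq, Fin.sum_univ_two, row_zero_ofRows, row_one_ofRows]

end

/-- An additive Haar measure on `ℂ² ⊗ ℂ^q`. -/
noncomputable def bipartiteVolume (q : Type*) [Fintype q] :
    Measure (EuclideanSpace ℂ (Fin 2 × q)) :=
  ((Measure.addHaar : Measure (EuclideanSpace ℂ q)).prod Measure.addHaar).map (ofRows q)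

/-- Any additive Haar measure would serve, as its normalisation cancels; this one makes the two rows
product coordinates, ready for Tonelli. -/
instance {q : Type*} [Fintype q] : (bipartiteVolume q).IsAddHaarMeasure :=
  ContinuousLinearEquiv.isAddHaarMeasure_map (ofRows q) _

/-- Both the integrand and the ball depend only on the two row norms, so polar coordinates in each
copy of `ℝ⁴` reduce the integral to the quarter disc. Dividing by `‖z‖²` makes the integrand a
function of the ratio alone. -/
theorem setLIntegral_ball_bipartiteVolume {α : ℝ} {g : ℝ → ENNReal} (hg : Measurable g) :
    ∫⁻ z in Metric.ball 0 1, g (2 * α * (‖row 0 z‖ * ‖row 1 z‖ / ‖z‖ ^ 2))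
        ∂bipartiteVolume (Fin 2)
      = (Measure.addHaar : Measure (EuclideanSpace ℂ (Fin 2))).toSphere Set.univ ^ 2 *
        (ENNReal.ofReal (1 / 8) * ∫⁻ u in Set.Ioi (0 : ℝ),
          ENNReal.ofReal (u ^ 3 / (1 + u ^ 2) ^ 4) * g (α * (2 * u / (1 + u ^ 2)))) := by
  set ν := (Measure.addHaar : Measure (EuclideanSpace ℂ (Fin 2)))
  let K : ℝ → ℝ → ENNReal := fun r s =>
    (Set.Iio 1).indicator (fun _ => g (2 * α * (r * s / (r ^ 2 + s ^ 2)))) (r ^ 2 + s ^ 2)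
  have hK : Measurable fun p : ℝ × ℝ => K p.1 p.2 := by
    have : (fun p : ℝ × ℝ => K p.1 p.2) = {p : ℝ × ℝ | p.1 ^ 2 + p.2 ^ 2 < 1}.indicator
        fun p => g (2 * α * (p.1 * p.2 / (p.1 ^ 2 + p.2 ^ 2))) := rfl
    rw [this]
    exact (hg.comp (by fun_prop)).indicator (measurableSet_lt (by fun_prop) (by fun_prop))
  have hF : Measurable fun z : EuclideanSpace ℂ (Fin 2 × Fin 2) =>
      g (2 * α * (‖row 0 z‖ * ‖row 1 z‖ / ‖z‖ ^ 2)) := by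
    refine hg.comp (((((continuous_row 0).norm.measurable).mul
      (continuous_row 1).norm.measurable).div ?_).const_mul _)
    exact (continuous_norm.pow 2).measurable
  have hdim : Module.finrank ℝ (EuclideanSpace ℂ (Fin 2)) = 4 := by
    rw [finrank_real_of_complex]
    simp
  calc ∫⁻ z in Metric.ball 0 1, g (2 * α * (‖row 0 z‖ * ‖row 1 z‖ / ‖z‖ ^ 2))
        ∂bipartiteVolume (Fin 2)
      = ∫⁻ p, K ‖p.1‖ ‖p.2‖ ∂ν.prod ν := by
        rw [← lintegral_indicator measurableSet_ball, bipartiteVolume,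
          lintegral_map (hF.indicator measurableSet_ball) (ofRows _).continuous.measurable]
        refine lintegral_congr fun p => ?_
        have hiff : ofRows (Fin 2) p ∈ Metric.ball 0 1 ↔ ‖p.1‖ ^ 2 + ‖p.2‖ ^ 2 ∈ Set.Iio 1 := by
          rw [mem_ball_zero_iff, ← norm_ofRows_sq, Set.mem_Iio, sq_lt_one_iff₀ (norm_nonneg _)]
        simp only [K]
        by_cases h : ofRows (Fin 2) p ∈ Metric.ball 0 1
        · rw [Set.indicator_of_mem h, Set.indicator_of_mem (hiff.1 h), norm_ofRows_sq,
            row_zero_ofRows, row_one_ofRows]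
        · rw [Set.indicator_of_notMem h, Set.indicator_of_notMem (mt hiff.2 h)]
    _ = ∫⁻ x, ∫⁻ y, K ‖x‖ ‖y‖ ∂ν ∂ν :=
        lintegral_prod _ (hK.comp (f := fun p : EuclideanSpace ℂ (Fin 2) ×
          EuclideanSpace ℂ (Fin 2) => (‖p.1‖, ‖p.2‖)) (by fun_prop)).aemeasurable
    _ = ∫⁻ x, ν.toSphere Set.univ *
          (∫⁻ s in Set.Ioi (0 : ℝ), ENNReal.ofReal (s ^ 3) * K ‖x‖ s) ∂ν := by
        refine lintegral_congr fun x => ?_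
        rw [lintegral_fun_norm_addHaar ν (f := K ‖x‖)
          (hK.comp (measurable_const.prodMk measurable_id)), hdim]
    _ = ν.toSphere Set.univ * ∫⁻ r in Set.Ioi (0 : ℝ), ENNReal.ofReal (r ^ 3) *
          (ν.toSphere Set.univ *
            ∫⁻ s in Set.Ioi (0 : ℝ), ENNReal.ofReal (s ^ 3) * K r s) := by
        rw [lintegral_fun_norm_addHaar ν (f := fun r => ν.toSphere Set.univ *
          ∫⁻ s in Set.Ioi (0 : ℝ), ENNReal.ofReal (s ^ 3) * K r s), hdim]
        refine Measurable.const_mul (Measurable.lintegral_prod_right'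
          (f := fun p : ℝ × ℝ => ENNReal.ofReal (p.2 ^ 3) * K p.1 p.2) ?_) _
        exact Measurable.mul (by fun_prop) hK
    _ = ν.toSphere Set.univ ^ 2 * ∫⁻ r in Set.Ioi (0 : ℝ), ENNReal.ofReal (r ^ 3) *
            ∫⁻ s in Set.Ioi (0 : ℝ), ENNReal.ofReal (s ^ 3) * K r s := by
        simp_rw [mul_left_comm _ (ν.toSphere Set.univ)]
        rw [lintegral_const_mul' _ _ (measure_ne_top _ _), ← mul_assoc, sq]
    _ = _ := by
        congr 1
        rw [← lintegral_quarterDisc_ratio (h := fun u => g (α * (2 * u / (1 + u ^ 2))))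
          (hg.comp (by fun_prop))]
        refine setLIntegral_congr_fun measurableSet_Ioi fun r hr => ?_
        have hr : 0 < r := hr
        simp only [K]
        congr 1
        refine lintegral_congr fun s => ?_
        have : 2 * α * (r * s / (r ^ 2 + s ^ 2))
            = α * (2 * (s / r) / (1 + (s / r) ^ 2)) := by
          have : r ^ 2 + s ^ 2 ≠ 0 := by positivity
          have : 1 + (s / r) ^ 2 ≠ 0 := by positivity
          field_simp
        rw [this]

theorem lintegral_haar_amplitudes {α : ℝ} (hα : 0 < α) (Φ : PureState (Fin 2 × Fin 2))
    {g : ℝ → ENNReal} (hg : Measurable g) :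
    ∫⁻ U, g (2 * α * (‖row 0 (unitaryIsometry U Φ.1)‖ * ‖row 1 (unitaryIsometry U Φ.1)‖))
        ∂haarUnitary (Fin 2 × Fin 2)
      = ∫⁻ x, ENNReal.ofReal (uncertaintyDensity α x) * g x := by
  set F : EuclideanSpace ℂ (Fin 2 × Fin 2) → ENNReal :=
    fun z => g (2 * α * (‖row 0 z‖ * ‖row 1 z‖ / ‖z‖ ^ 2)) with hF
  have hFm : Measurable F := by
    refine hg.comp (((((continuous_row 0).norm.measurable).mul
      (continuous_row 1).norm.measurable).div ?_).const_mul _)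
    exact (continuous_norm.pow 2).measurable
  have h := setLIntegral_ball_eq_lintegral_act (bipartiteVolume (Fin 2)) Φ hFm (by
    intro c z hc
    simp only [F, row_smul, norm_smul, Real.norm_eq_abs, abs_of_pos hc]
    congr 2
    by_cases hz : ‖z‖ = 0
    · simp [hz]
    · field_simp)
  have hU : ∀ U : unitaryGroup (Fin 2 × Fin 2) ℂ, F (unitaryIsometry U Φ.1)
      = g (2 * α * (‖row 0 (unitaryIsometry U Φ.1)‖ * ‖row 1 (unitaryIsometry U Φ.1)‖)) := by
    intro U
    have h1 : ‖unitaryIsometry U Φ.1‖ = 1 := by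
      rw [LinearIsometryEquiv.norm_map]
      exact mem_sphere_zero_iff_norm.1 Φ.2
    simp [F, h1]
  -- The same formula with `g = 1` gives the volume in terms of the unevaluated sphere mass, which
  -- therefore cancels.
  have hvol : bipartiteVolume (Fin 2) (Metric.ball 0 1)
      = (Measure.addHaar : Measure (EuclideanSpace ℂ (Fin 2))).toSphere Set.univ ^ 2 *
        (ENNReal.ofReal (1 / 8) * ENNReal.ofReal (1 / 12)) := by
    have h1 := setLIntegral_ball_bipartiteVolume (α := α) (g := fun _ => 1) measurable_const
    simpa only [setLIntegral_one, mul_one, lintegral_ratio_density] using h1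
  simp_rw [hU] at h
  rw [hF, setLIntegral_ball_bipartiteVolume hg, lintegral_ratio_eq_lintegral_uncertaintyDensity hα,
    ← mul_assoc (ENNReal.ofReal (1 / 8)), ← mul_assoc, ← hvol] at h
  exact ((ENNReal.mul_right_inj (Metric.measure_ball_pos _ _ one_pos).ne'
    measure_ball_lt_top.ne).1 h).symm

theorem measurable_uncertaintyDensity (α : ℝ) : Measurable (uncertaintyDensity α) := by
  refine Measurable.indicator ?_ measurableSet_Ico
  fun_prop

end RandomQubit

/-! ### The law of the uncertainty. -/

theorem proposition5 (a₀ : ℝ) (a : EuclideanSpace ℝ (Fin 3)) (ha : a ≠ 0)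
    (Φ : RandomQubit.PureState (Fin 2 × Fin 2)) :
    Measurable (RandomQubit.stdDev (RandomQubit.qubitObs a₀ a)) ∧
    (RandomQubit.inducedMeasure Φ).map (RandomQubit.stdDev (RandomQubit.qubitObs a₀ a)) =
      (volume : Measure ℝ).withDensity (fun x : ℝ => ENNReal.ofReal
        ((Set.Ico 0 ‖a‖).indicator
          (fun x => 3 * x ^ 3 / (2 * ‖a‖ ^ 3 * Real.sqrt (‖a‖ ^ 2 - x ^ 2))) x)) := by
  have hm := RandomQubit.measurable_stdDev (RandomQubit.qubitObs a₀ a)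
  refine ⟨hm, Measure.ext_of_lintegral _ fun g hg => ?_⟩
  obtain ⟨W, hW⟩ := RandomQubit.exists_stdDev_qubitObs_eq (q := Fin 2) a₀ a
  rw [RandomQubit.lintegral_map_inducedMeasure Φ hm hg]
  simp only [hW, RandomQubit.act_val, ← RandomQubit.unitaryIsometry_mul]
  -- Left invariance of Haar measure absorbs the diagonalising unitary `W`.
  rw [lintegral_mul_left_eq_self (fun U => g (2 * ‖a‖ *
    (‖RandomQubit.row 0 (RandomQubit.unitaryIsometry U Φ.1)‖ *
      ‖RandomQubit.row 1 (RandomQubit.unitaryIsometry U Φ.1)‖))) W,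
    RandomQubit.lintegral_haar_amplitudes (norm_pos_iff.2 ha) Φ hg]
  exact (lintegral_withDensity_eq_lintegral_mul _
    (RandomQubit.measurable_uncertaintyDensity ‖a‖).ennreal_ofReal hg).symm
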